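/- Let $n\ge 1$, let $M$ be a compact smooth $n$-dimensional manifold without boundary (Hausdorff, not necessarily connected or orientable), let $g$ be a smooth Riemannian metric on $M$, and let $\phi:(M,g)\to\mathbb E^m$ be a smooth isometric immersion into Euclidean $m$-space, with position vector field $\mathbf x=\phi(p)$, $p\in M$. Let $\mathbf x^T$ be the tangential component of $\mathbf x$, i.e. the vector field on $M$ such that $d\phi(\mathbf x^T)$ is at each point $p$ the orthogonal projection of $\mathbf x$ onto $d\phi(T_pM)$, and let $(\mathbf x^T)^\flat=g(\mathbf x^T,\cdot)$ be its dual $1$-form. Let $h$ be the second fundamental form of $\phi$, given by $\widetilde\nabla_XY=\nabla_XY+h(X,Y)$, where $\nabla$ and $\widetilde\nabla$ are the Levi-Civita connections of $(M,g)$ and $\mathbb E^m$, and let $H=\frac1n\operatorname{trace}_g h$ be the mean curvature vector. Call a $1$-form $\theta$ on $M$ harmonic if $\Delta\theta=0$, where $\Delta=d\delta+\delta d$ is the Laplace–Hodge operator of $(M,g)$. Then $(\mathbf x^T)^\flat$ is harmonic if and only if $\langle\mathbf x,H\rangle=-1$ holds identically on $M$. -/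

import Mathlib

open scoped Manifold ContDiff

noncomputable section

namespace EuclideanSubmanifold

/-- The Euclidean space of dimension `n`. -/
abbrev E (n : ℕ) : Type := EuclideanSpace ℝ (Fin n)

section Forms

variable {n : ℕ} {M : Type*} [TopologicalSpace M] [ChartedSpace (E n) M]

/-- Covariant tensor fields of order one on `M`; in particular (differential) `1`-forms. -/
abbrev OneForm (n : ℕ) (M : Type*) [TopologicalSpace M] [ChartedSpace (E n) M] : Type _ :=
  ∀ p : M, TangentSpace (𝓡 n) p →L[ℝ] ℝ

/-- Covariant tensor fields of order two on `M`; a `2`-form is an alternating one. -/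
abbrev TwoTensor (n : ℕ) (M : Type*) [TopologicalSpace M] [ChartedSpace (E n) M] : Type _ :=
  ∀ p : M, TangentSpace (𝓡 n) p →L[ℝ] TangentSpace (𝓡 n) p →L[ℝ] ℝ

/-- Smooth Riemannian metrics on `M`. -/
abbrev RiemannianMetric (n : ℕ) (M : Type*) [TopologicalSpace M] [ChartedSpace (E n) M]
    [IsManifold (𝓡 n) ∞ M] : Type _ :=
  haveI : IsManifold (𝓡 n) 1 M := IsManifold.of_le (n := ∞) (by norm_num)
  Bundle.ContMDiffRiemannianMetric (𝓡 n) ∞ (E n) (fun p : M => TangentSpace (𝓡 n) p)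

/-! ### Coordinate expressions in a chart `e` -/

/-- The partial derivative `∂ᵢ f` of a vector-valued function on `ℝⁿ`. -/
def partialD {F : Type*} [NormedAddCommGroup F] [NormedSpace ℝ F]
    (i : Fin n) (f : E n → F) (u : E n) : F :=
  fderiv ℝ f u (EuclideanSpace.single i 1)

/-- The coordinate vector `∂ᵢ` of the chart `e`, at the point with coordinates `u`. -/
def coordVec (e : OpenPartialHomeomorph M (E n)) (i : Fin n) (u : E n) :
    TangentSpace (𝓡 n) (e.symm u) :=
  mfderiv (𝓡 n) (𝓡 n) e.symm u (EuclideanSpace.single i (1 : ℝ) : E n)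

/-- The `i`-th component of a tangent vector at `q` in the chart `e`. -/
def component (e : OpenPartialHomeomorph M (E n)) (q : M) (i : Fin n) :
    TangentSpace (𝓡 n) q →L[ℝ] ℝ :=
  (EuclideanSpace.proj i : E n →L[ℝ] ℝ) ∘L
    (mfderiv (𝓡 n) (𝓡 n) e q : TangentSpace (𝓡 n) q →L[ℝ] E n)

/-- The coefficients `θᵢ = θ(∂ᵢ)`. -/
def coeff₁ (θ : OneForm n M) (e : OpenPartialHomeomorph M (E n)) (i : Fin n) (u : E n) : ℝ :=
  θ (e.symm u) (coordVec e i u)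

/-- The coefficients `αᵢⱼ = α(∂ᵢ, ∂ⱼ)`. -/
def coeff₂ (α : TwoTensor n M) (e : OpenPartialHomeomorph M (E n)) (i j : Fin n) (u : E n) : ℝ :=
  α (e.symm u) (coordVec e i u) (coordVec e j u)

/-- The exterior derivative of a `1`-form,
`dθ = ∑ᵢⱼ (∂ᵢ θⱼ - ∂ⱼ θᵢ) dxⁱ ⊗ dxʲ`, so that `dθ(∂ᵢ, ∂ⱼ) = ∂ᵢ θⱼ - ∂ⱼ θᵢ`. -/
def extDeriv₁ (θ : OneForm n M) : TwoTensor n M := fun q =>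
  let e := chartAt (E n) q
  ∑ i, ∑ j, (partialD i (coeff₁ θ e j) (e q) - partialD j (coeff₁ θ e i) (e q)) •
    (component e q i).smulRight (component e q j)

variable [IsManifold (𝓡 n) ∞ M]

/-- The matrix `gᵢⱼ = g(∂ᵢ, ∂ⱼ)`. -/
def metricMatrix (g : RiemannianMetric n M) (e : OpenPartialHomeomorph M (E n)) (u : E n) :
    Matrix (Fin n) (Fin n) ℝ :=
  Matrix.of fun i j => coeff₂ g.inner e i j u

/-- The Christoffel symbols `Γᵏᵢⱼ = ½ ∑ₗ gᵏˡ (∂ᵢ gⱼₗ + ∂ⱼ gᵢₗ - ∂ₗ gᵢⱼ)` of the Levi-Civita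
connection `∇`, i.e. `∇_{∂ᵢ} ∂ⱼ = ∑ₖ Γᵏᵢⱼ ∂ₖ`. -/
def christoffel (g : RiemannianMetric n M) (e : OpenPartialHomeomorph M (E n))
    (k i j : Fin n) (u : E n) : ℝ :=
  (1 / 2) * ∑ l, (metricMatrix g e u)⁻¹ k l *
    (partialD i (coeff₂ g.inner e j l) u + partialD j (coeff₂ g.inner e i l) u
      - partialD l (coeff₂ g.inner e i j) u)

/-- `(∇_{∂ᵢ} θ)(∂ⱼ) = ∂ᵢ θⱼ - ∑ₖ Γᵏᵢⱼ θₖ`. -/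
def covDeriv₁ (g : RiemannianMetric n M) (θ : OneForm n M) (e : OpenPartialHomeomorph M (E n))
    (i j : Fin n) (u : E n) : ℝ :=
  partialD i (coeff₁ θ e j) u - ∑ k, christoffel g e k i j u * coeff₁ θ e k u

/-- `(∇_{∂ₖ} α)(∂ᵢ, ∂ⱼ) = ∂ₖ αᵢⱼ - ∑ₗ Γˡₖᵢ αₗⱼ - ∑ₗ Γˡₖⱼ αᵢₗ`. -/
def covDeriv₂ (g : RiemannianMetric n M) (α : TwoTensor n M) (e : OpenPartialHomeomorph M (E n))
    (k i j : Fin n) (u : E n) : ℝ :=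
  partialD k (coeff₂ α e i j) u - ∑ l, christoffel g e l k i u * coeff₂ α e l j u
    - ∑ l, christoffel g e l k j u * coeff₂ α e i l u

/-! ### The Laplace–Hodge operator on `1`-forms -/

/-- The codifferential of a `1`-form, `δθ = - ∑ᵢⱼ gⁱʲ (∇_{∂ᵢ} θ)(∂ⱼ)`. -/
def codiff₁ (g : RiemannianMetric n M) (θ : OneForm n M) (q : M) : ℝ :=
  let e := chartAt (E n) q
  (-1) * ∑ i, ∑ j, (metricMatrix g e (e q))⁻¹ i j * covDeriv₁ g θ e i j (e q)

/-- The codifferential of a `2`-form, `(δα)(∂ⱼ) = - ∑ₖᵢ gᵏⁱ (∇_{∂ₖ} α)(∂ᵢ, ∂ⱼ)`. -/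
def codiff₂ (g : RiemannianMetric n M) (α : TwoTensor n M) : OneForm n M := fun q =>
  let e := chartAt (E n) q
  ∑ j, ((-1) * ∑ k, ∑ i, (metricMatrix g e (e q))⁻¹ k i * covDeriv₂ g α e k i j (e q)) •
    component e q j

/-- The Laplace–Hodge operator `Δ = dδ + δd` on `1`-forms. -/
def hodgeLaplacian (g : RiemannianMetric n M) (θ : OneForm n M) : OneForm n M := fun q =>
  mvfderiv (𝓡 n) (codiff₁ g θ) q + codiff₂ g (extDeriv₁ θ) q

/-- A `1`-form `θ` is harmonic if `Δθ = 0`. -/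
def IsHarmonicForm (g : RiemannianMetric n M) (θ : OneForm n M) : Prop :=
  ∀ q, hodgeLaplacian g θ q = 0

/-- The dual `1`-form `X♭ = g(X, ·)` of a vector field `X`. -/
def flat (g : RiemannianMetric n M) (X : ∀ p : M, TangentSpace (𝓡 n) p) : OneForm n M :=
  fun p => g.inner p (X p)

end Forms

/-! ### Submanifolds of Euclidean space -/

section Submanifold

variable {n m : ℕ} {M : Type*} [TopologicalSpace M] [ChartedSpace (E n) M]

/-- The tangent space `dφ(T_p M)` of the submanifold, as a subspace of the ambient space. -/
def tangentRange (φ : M → E m) (p : M) : Submodule ℝ (E m) :=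
  LinearMap.range (mvfderiv (𝓡 n) φ p).toLinearMap

/-- The tangential component of the position vector is the image of a tangent vector of `M`. -/
theorem exists_tangent_part (φ : M → E m) (p : M) :
    ∃ v : TangentSpace (𝓡 n) p,
      mvfderiv (𝓡 n) φ p v = (tangentRange (n := n) φ p).starProjection (φ p) :=
  LinearMap.mem_range.1 (Submodule.starProjection_apply_mem (tangentRange (n := n) φ p) (φ p))

/-- The canonical vector field `𝐱ᵀ`: the tangent vector field on `M` whose image under `dφ` is the
orthogonal projection of the position vector `𝐱 = φ(p)` onto the tangent space `dφ(T_p M)`. It is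
unique as soon as `φ` is an immersion. -/
def canonicalField (φ : M → E m) (p : M) : TangentSpace (𝓡 n) p :=
  (exists_tangent_part φ p).choose

variable [IsManifold (𝓡 n) ∞ M]

/-- `φ : (M, g) → 𝔼ᵐ` is a smooth isometric immersion. (It is an immersion since `g` is positive
definite.) -/
structure IsIsometricImmersion (g : RiemannianMetric n M) (φ : M → E m) : Prop where
  contMDiff : ContMDiff (𝓡 n) (𝓡 m) ∞ φ
  isometric : ∀ (p : M) (v w : TangentSpace (𝓡 n) p),
    g.inner p v w = inner ℝ (mvfderiv (𝓡 n) φ p v) (mvfderiv (𝓡 n) φ p w)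

/-- The second fundamental form `h(∂ᵢ, ∂ⱼ)` of `φ`, given by the formula of Gauss
`∇̃_{∂ᵢ} ∂ⱼ = ∇_{∂ᵢ} ∂ⱼ + h(∂ᵢ, ∂ⱼ)`, where vectors tangent to `M` are viewed as
ambient vectors through `dφ` and `∇̃` is the flat connection of the ambient space. -/
def secondFundamentalForm (g : RiemannianMetric n M) (φ : M → E m)
    (e : OpenPartialHomeomorph M (E n)) (i j : Fin n) (u : E n) : E m :=
  partialD i (partialD j (φ ∘ e.symm)) u
    - ∑ k, christoffel g e k i j u • partialD k (φ ∘ e.symm) u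

/-- The mean curvature vector `H = (1/n) trace h = (1/n) ∑ᵢⱼ gⁱʲ h(∂ᵢ, ∂ⱼ)`. -/
def meanCurvature (g : RiemannianMetric n M) (φ : M → E m) (q : M) : E m :=
  let e := chartAt (E n) q
  (1 / (n : ℝ)) • ∑ i, ∑ j, (metricMatrix g e (e q))⁻¹ i j •
    secondFundamentalForm g φ e i j (e q)

end Submanifold

end EuclideanSubmanifold

end

open scoped Manifold ContDiff Topology

noncomputable section

namespace EuclideanSubmanifold

/-! ### Linear algebra and calculus in `ℝⁿ` -/

section Calculus

/-! Write θ for the form `(𝐱ᵀ)♭`. Since `𝐱 - 𝐱ᵀ` is normal, θ is the differential of `|𝐱|²/2`. Hence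
θ is closed (`extDeriv₁_flat_canonicalField`) and `Δθ = dδθ`. From `∇θ = g + ⟨𝐱, h⟩`
(`covDeriv₁_flat`), the trace gives `δθ = -n(1 + ⟨𝐱, H⟩)` (`codiff₁_flat_eq`). So `⟨𝐱, H⟩ = -1`
means `δθ = 0`, which makes θ harmonic.

Conversely, harmonicity makes `δθ` locally constant, and compactness must force the constant to be
zero. No integration is used, so orientability plays no role: on a clopen fibre of `δθ`, the
function `|𝐱|²/2`, whose Laplacian is `-δθ`, attains its maximum and its minimum, and the signs of
the Hessian there give `δθ ≥ 0` and `δθ ≤ 0` (`mul_traceInner_nonpos_of_isLocalMax`,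
`codiff₁_flat_eq_zero`).

Because `codiff₁` uses the preferred chart of each point, differentiating it requires chart
independence of the trace (`traceInner_transition`). -/

theorem sndFDeriv_self_nonpos_of_isLocalMax {V : Type*} [NormedAddCommGroup V] [NormedSpace ℝ V]
    {f : V → ℝ} {x : V} (hf : ContDiffAt ℝ 2 f x) (hmax : IsLocalMax f x) (v : V) :
    fderiv ℝ (fderiv ℝ f) x v v ≤ 0 := by
  let c : ℝ → V := fun t => x + t • v
  have hc : ∀ t, HasDerivAt c v t := fun t => by
    simpa [c] using ((hasDerivAt_id t).smul_const v).const_add x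
  have hc0 : c 0 = x := by simp [c]
  have hcont : Filter.Tendsto c (𝓝 0) (𝓝 x) := by
    have := (hc 0).continuousAt
    rwa [ContinuousAt, hc0] at this
  have h1 : ∀ᶠ y in 𝓝 x, DifferentiableAt ℝ f y :=
    (hf.eventually (by simp)).mono fun y hy => hy.differentiableAt (by simp)
  have hd : deriv (f ∘ c) =ᶠ[𝓝 0] fun t => fderiv ℝ f (c t) v :=
    (hcont.eventually h1).mono fun t ht => (ht.hasFDerivAt.comp_hasDerivAt t (hc t)).deriv
  have h2 : DifferentiableAt ℝ (fderiv ℝ f) x :=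
    (hf.fderiv_right (m := 1) (by norm_num)).differentiableAt (by simp)
  have hdd : deriv (deriv (f ∘ c)) 0 = fderiv ℝ (fderiv ℝ f) x v v := by
    rw [hd.deriv_eq]
    have h3 : HasFDerivAt (fderiv ℝ f) (fderiv ℝ (fderiv ℝ f) x) (c 0) := by
      rw [hc0]; exact h2.hasFDerivAt
    have h4 := (h3.comp_hasDerivAt 0 (hc 0)).clm_apply (hasDerivAt_const 0 v)
    simpa using h4.deriv
  have hmax' : IsLocalMax (f ∘ c) 0 := by
    have : ∀ᶠ t in 𝓝 (0 : ℝ), f (c t) ≤ f x := hcont.eventually hmax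
    simpa [IsLocalMax, IsMaxFilter, hc0] using this
  by_contra! hpos
  rw [← hdd] at hpos
  have hcc : ContinuousAt (f ∘ c) 0 :=
    ContinuousAt.comp (by rw [hc0]; exact hf.continuousAt) (hc 0).continuousAt
  -- A positive second derivative along the line would make the maximum a minimum too, so the
  -- restriction would be locally constant and its second derivative zero.
  have hmin := isLocalMin_of_deriv_deriv_pos hpos hmax'.deriv_eq_zero hcc
  have hconst : f ∘ c =ᶠ[𝓝 0] fun _ => (f ∘ c) 0 := by
    filter_upwards [hmin, hmax'] with t ht ht'
    exact le_antisymm ht' ht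
  have := hconst.deriv.deriv_eq
  simp at this
  exact hpos.ne' this

/-- Factoring `A = CᵀC` turns the sum into values of the quadratic form of `B` on the rows of `C`.
-/
theorem sum_mul_nonpos_of_posSemidef {n : ℕ} {A B : Matrix (Fin n) (Fin n) ℝ}
    (hA : A.PosSemidef) (hB : ∀ c : Fin n → ℝ, ∑ i, ∑ j, c i * c j * B i j ≤ 0) :
    ∑ i, ∑ j, A i j * B i j ≤ 0 := by
  obtain ⟨C, rfl⟩ : ∃ C : Matrix (Fin n) (Fin n) ℝ, A = C.conjTranspose * C := by
    open scoped MatrixOrder in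
    exact CStarAlgebra.nonneg_iff_eq_star_mul_self.1 hA.nonneg
  have : ∑ i, ∑ j, (C.conjTranspose * C) i j * B i j
      = ∑ k, ∑ i, ∑ j, C k i * C k j * B i j := by
    simp only [Matrix.mul_apply, Matrix.conjTranspose_apply, star_trivial, Finset.sum_mul]
    rw [Finset.sum_comm (f := fun k i => ∑ j, C k i * C k j * B i j)]
    exact Finset.sum_congr rfl fun i _ => Finset.sum_comm
  rw [this]
  exact Finset.sum_nonpos fun k _ => hB (C k)

/-- The sum is the trace of `G⁻¹Bᵀ`; a congruence of both forms conjugates this product by `J`. This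
is the invariance of a metric trace under change of coordinates. -/
theorem sum_inv_mul_congr {n : ℕ} {G B J : Matrix (Fin n) (Fin n) ℝ}
    (hJ : IsUnit J.det) :
    ∑ i, ∑ j, (J.transpose * G * J)⁻¹ i j * (J.transpose * B * J) i j
      = ∑ i, ∑ j, G⁻¹ i j * B i j := by
  have key : ∀ P Q : Matrix (Fin n) (Fin n) ℝ,
      ∑ i, ∑ j, P i j * Q i j = (P * Q.transpose).trace := fun P Q => by
    simp [Matrix.trace, Matrix.mul_apply]
  rw [key, key, Matrix.mul_inv_rev, Matrix.mul_inv_rev]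
  have hJ' : IsUnit J.transpose.det := by rwa [Matrix.det_transpose]
  simp only [Matrix.transpose_mul, Matrix.transpose_transpose]
  calc (J⁻¹ * (G⁻¹ * J.transpose⁻¹) * (J.transpose * (B.transpose * J))).trace
      = (J⁻¹ * (G⁻¹ * (J.transpose⁻¹ * J.transpose) * B.transpose * J)).trace := by
        simp only [Matrix.mul_assoc]
    _ = (J * J⁻¹ * (G⁻¹ * B.transpose)).trace := by
        rw [Matrix.nonsing_inv_mul _ hJ', Matrix.mul_one, Matrix.trace_mul_comm,
          Matrix.mul_assoc, Matrix.trace_mul_comm]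
    _ = _ := by rw [Matrix.mul_nonsing_inv _ hJ, Matrix.one_mul]

variable {n : ℕ} {F : Type*} [NormedAddCommGroup F] [NormedSpace ℝ F]

theorem sum_smul_single (v : E n) : ∑ i, v i • (EuclideanSpace.single i (1 : ℝ) : E n) = v := by
  ext j
  simp [Pi.single_apply]

/-- The matrix of the pullback of a bilinear form under a linear map. -/
theorem bilin_map_single (B : E n →L[ℝ] E n →L[ℝ] ℝ) (T : E n →L[ℝ] E n) :
    (Matrix.of fun i j => B (T (EuclideanSpace.single i 1)) (T (EuclideanSpace.single j 1)))
      = (Matrix.of fun a i => T (EuclideanSpace.single i 1) a).transpose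
        * (Matrix.of fun a b => B (EuclideanSpace.single a 1) (EuclideanSpace.single b 1))
        * (Matrix.of fun a i => T (EuclideanSpace.single i 1) a) := by
  ext i j
  simp only [Matrix.of_apply, Matrix.mul_apply, Matrix.transpose_apply]
  conv_lhs => rw [← sum_smul_single (T (EuclideanSpace.single i 1)),
    ← sum_smul_single (T (EuclideanSpace.single j 1))]
  simp only [map_sum, map_smul, sum_apply, smul_apply,
    smul_eq_mul, Finset.sum_mul, Finset.mul_sum]
  refine Finset.sum_congr rfl fun a _ => ?_
  refine Finset.sum_congr rfl fun b _ => by ring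

theorem partialD_congr {f f' : E n → F} {u : E n} (h : f =ᶠ[𝓝 u] f') (i : Fin n) :
    partialD i f u = partialD i f' u := by
  rw [partialD, h.fderiv_eq, partialD]

theorem contDiffAt_partialD {f : E n → F} {u : E n} (hf : ContDiffAt ℝ ∞ f u) (i : Fin n) :
    ContDiffAt ℝ ∞ (partialD i f) u :=
  (hf.fderiv_right (m := ∞) (by simp)).clm_apply contDiffAt_const

theorem partialD_partialD {f : E n → F} {u : E n} (hf : ContDiffAt ℝ ∞ f u) (i j : Fin n) :
    partialD i (partialD j f) u
      = fderiv ℝ (fderiv ℝ f) u (EuclideanSpace.single i 1) (EuclideanSpace.single j 1) := by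
  have h : DifferentiableAt ℝ (fderiv ℝ f) u :=
    (hf.fderiv_right (m := ∞) (by simp)).differentiableAt (by simp)
  have := (h.hasFDerivAt.clm_apply
    (hasFDerivAt_const (EuclideanSpace.single j (1 : ℝ) : E n) u)).fderiv
  unfold partialD
  rw [this]
  simp

theorem partialD_comm {f : E n → F} {u : E n} (hf : ContDiffAt ℝ ∞ f u) (i j : Fin n) :
    partialD i (partialD j f) u = partialD j (partialD i f) u := by
  rw [partialD_partialD hf, partialD_partialD hf]
  exact hf.isSymmSndFDerivAt (by simp; norm_cast) _ _

theorem partialD_inner {m : ℕ} {a b : E n → E m} {u : E n} (ha : DifferentiableAt ℝ a u)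
    (hb : DifferentiableAt ℝ b u) (i : Fin n) :
    partialD i (fun v => inner ℝ (a v) (b v)) u
      = inner ℝ (partialD i a u) (b u) + inner ℝ (a u) (partialD i b u) := by
  rw [partialD, fderiv_inner_apply ℝ ha hb, add_comm]
  rfl

/-- The chain rule for second derivatives. -/
theorem sndFDeriv_comp {ψ : E n → E n} {f : E n → F} {u : E n} (hψ : ContDiffAt ℝ ∞ ψ u)
    (hf : ContDiffAt ℝ ∞ f (ψ u)) (v w : E n) :
    fderiv ℝ (fderiv ℝ (f ∘ ψ)) u v w
      = fderiv ℝ (fderiv ℝ f) (ψ u) (fderiv ℝ ψ u v) (fderiv ℝ ψ u w)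
        + fderiv ℝ f (ψ u) (fderiv ℝ (fderiv ℝ ψ) u v w) := by
  have e1 : ∀ᶠ x in 𝓝 u, DifferentiableAt ℝ ψ x :=
    ((hψ.of_le (m := 1) (by simp)).eventually (by simp)).mono
      fun y hy => hy.differentiableAt (by simp)
  have e2 : ∀ᶠ x in 𝓝 u, DifferentiableAt ℝ f (ψ x) :=
    hψ.continuousAt.eventually (((hf.of_le (m := 1) (by simp)).eventually (by simp)).mono
      fun y hy => hy.differentiableAt (by simp))
  have e3 : fderiv ℝ (f ∘ ψ) =ᶠ[𝓝 u] fun x => (fderiv ℝ f (ψ x)).comp (fderiv ℝ ψ x) := by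
    filter_upwards [e1, e2] with x h1 h2
    exact fderiv_comp x h2 h1
  have d1 : DifferentiableAt ℝ (fderiv ℝ f) (ψ u) :=
    (hf.fderiv_right (m := ∞) (by simp)).differentiableAt (by simp)
  have d2 : DifferentiableAt ℝ (fderiv ℝ ψ) u :=
    (hψ.fderiv_right (m := ∞) (by simp)).differentiableAt (by simp)
  have d3 : DifferentiableAt ℝ ψ u := hψ.differentiableAt (by simp)
  rw [e3.fderiv_eq]
  have := ((d1.hasFDerivAt.comp u d3.hasFDerivAt).clm_comp d2.hasFDerivAt).fderiv
  simp only [Function.comp_def] at this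
  rw [this]
  simp [add_comm]

end Calculus

/-! ### Coordinate formulas for θ, its covariant derivative and the second fundamental form -/

section Chart

variable {n m : ℕ} {M : Type*} [TopologicalSpace M] [ChartedSpace (E n) M]
  [IsManifold (𝓡 n) ∞ M] {g : RiemannianMetric n M} {φ : M → E m}
  {e e' : OpenPartialHomeomorph M (E n)} {u : E n}

theorem contDiffAt_comp_symm (hφ : IsIsometricImmersion g φ)
    (he : e ∈ atlas (E n) M) (hu : u ∈ e.target) : ContDiffAt ℝ ∞ (φ ∘ e.symm) u := by
  have h := contMDiffAt_symm_of_mem_maximalAtlas (I := 𝓡 n) (n := ∞)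
    (IsManifold.subset_maximalAtlas he) hu
  exact (hφ.contMDiff.contMDiffAt.comp u h).contDiffAt

theorem contDiffAt_transition (he : e ∈ atlas (E n) M) (he' : e' ∈ atlas (E n) M)
    (hu : u ∈ e.target) (hu' : e.symm u ∈ e'.source) :
    ContDiffAt ℝ ∞ (e' ∘ e.symm) u := by
  have h := contMDiffAt_symm_of_mem_maximalAtlas (I := 𝓡 n) (n := ∞)
    (IsManifold.subset_maximalAtlas he) hu
  have h' := contMDiffAt_of_mem_maximalAtlas (I := 𝓡 n) (n := ∞)
    (IsManifold.subset_maximalAtlas he') hu'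
  exact (h'.comp u h).contDiffAt

theorem mdifferentiable_of_mem_atlas (he : e ∈ atlas (E n) M) :
    e.MDifferentiable (𝓡 n) (𝓡 n) :=
  haveI : IsManifold (𝓡 n) 1 M := IsManifold.of_le (n := ∞) (by norm_num)
  _root_.mdifferentiable_of_mem_atlas he

theorem fderiv_comp_symm (hφ : IsIsometricImmersion g φ) (he : e ∈ atlas (E n) M)
    (hu : u ∈ e.target) (v : E n) :
    fderiv ℝ (φ ∘ e.symm) u v
      = mvfderiv (𝓡 n) φ (e.symm u) (mfderiv (𝓡 n) (𝓡 n) e.symm u v) := by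
  rw [← mfderiv_eq_fderiv]
  exact mfderiv_comp_apply u (hφ.contMDiff.mdifferentiableAt (by simp))
    ((mdifferentiable_of_mem_atlas he).mdifferentiableAt_symm hu) v

theorem coeff₂_inner (hφ : IsIsometricImmersion g φ) (he : e ∈ atlas (E n) M)
    (hu : u ∈ e.target) (i j : Fin n) :
    coeff₂ g.inner e i j u
      = inner ℝ (partialD i (φ ∘ e.symm) u) (partialD j (φ ∘ e.symm) u) := by
  rw [coeff₂, hφ.isometric, partialD, partialD, fderiv_comp_symm hφ he hu,
    fderiv_comp_symm hφ he hu]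
  rfl

/-- Coordinate vectors are tangent, so they do not see the normal part of the position vector. The
right side is the partial derivative of `|𝐱|²/2`. -/
theorem coeff₁_flat_canonicalField (hφ : IsIsometricImmersion g φ) (he : e ∈ atlas (E n) M)
    (hu : u ∈ e.target) (j : Fin n) :
    coeff₁ (flat g (canonicalField φ)) e j u
      = inner ℝ ((φ ∘ e.symm) u) (partialD j (φ ∘ e.symm) u) := by
  rw [coeff₁, flat, hφ.isometric, canonicalField, (exists_tangent_part φ (e.symm u)).choose_spec,
    partialD, fderiv_comp_symm hφ he hu]
  have := Submodule.starProjection_inner_eq_zero (K := tangentRange (n := n) φ (e.symm u))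
    (φ (e.symm u)) (mvfderiv (𝓡 n) φ (e.symm u) (coordVec e j u)) ⟨_, rfl⟩
  rw [inner_sub_left, sub_eq_zero] at this
  exact this.symm

omit [ChartedSpace (E n) M] [IsManifold (𝓡 n) ∞ M] in
theorem eventually_mem_target (hu : u ∈ e.target) : ∀ᶠ v in 𝓝 u, v ∈ e.target :=
  e.open_target.mem_nhds hu

theorem partialD_coeff₂_inner (hφ : IsIsometricImmersion g φ) (he : e ∈ atlas (E n) M)
    (hu : u ∈ e.target) (i j k : Fin n) :
    partialD k (coeff₂ g.inner e i j) u
      = inner ℝ (partialD k (partialD i (φ ∘ e.symm)) u) (partialD j (φ ∘ e.symm) u)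
        + inner ℝ (partialD i (φ ∘ e.symm) u) (partialD k (partialD j (φ ∘ e.symm)) u) := by
  have hc := contDiffAt_comp_symm hφ he hu
  rw [← partialD_inner ((contDiffAt_partialD hc i).differentiableAt (by simp))
    ((contDiffAt_partialD hc j).differentiableAt (by simp))]
  exact partialD_congr ((eventually_mem_target hu).mono fun v hv => coeff₂_inner hφ he hv i j) k

theorem partialD_coeff₁_flat (hφ : IsIsometricImmersion g φ) (he : e ∈ atlas (E n) M)
    (hu : u ∈ e.target) (i j : Fin n) :
    partialD i (coeff₁ (flat g (canonicalField φ)) e j) u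
      = coeff₂ g.inner e i j u
        + inner ℝ ((φ ∘ e.symm) u) (partialD i (partialD j (φ ∘ e.symm)) u) := by
  have hc := contDiffAt_comp_symm hφ he hu
  rw [coeff₂_inner hφ he hu, ← partialD_inner (hc.differentiableAt (by simp))
    ((contDiffAt_partialD hc j).differentiableAt (by simp))]
  exact partialD_congr ((eventually_mem_target hu).mono fun v hv =>
    coeff₁_flat_canonicalField hφ he hv j) i

theorem coeff₂_inner_comm (i j : Fin n) : coeff₂ g.inner e i j u = coeff₂ g.inner e j i u :=
  g.symm _ _ _

theorem metricMatrix_apply (i j : Fin n) : metricMatrix g e u i j = coeff₂ g.inner e i j u := rfl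

/-- `(𝐱ᵀ)♭` is closed. -/
theorem extDeriv₁_flat_canonicalField (hφ : IsIsometricImmersion g φ) :
    extDeriv₁ (flat g (canonicalField φ)) = 0 := by
  funext q
  have he := chart_mem_atlas (E n) q
  have hu := mem_chart_target (E n) q
  refine Finset.sum_eq_zero fun i _ => Finset.sum_eq_zero fun j _ => ?_
  rw [partialD_coeff₁_flat hφ he hu, partialD_coeff₁_flat hφ he hu, coeff₂_inner_comm i j,
    partialD_comm (contDiffAt_comp_symm hφ he hu) i j, sub_self]
  exact ContinuousLinearMap.ext fun v => ContinuousLinearMap.ext fun w => zero_mul _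

theorem codiff₂_zero : codiff₂ g (0 : TwoTensor n M) = 0 := by
  have h0 : ∀ (e : OpenPartialHomeomorph M (E n)) (i j : Fin n),
      coeff₂ (0 : TwoTensor n M) e i j = fun _ => 0 := fun _ _ _ => rfl
  funext q
  refine Finset.sum_eq_zero fun j _ => ?_
  simp [covDeriv₂, h0, partialD]

theorem posDef_metricMatrix (he : e ∈ atlas (E n) M) (hu : u ∈ e.target) :
    (metricMatrix g e u).PosDef := by
  refine Matrix.PosDef.of_dotProduct_mulVec_pos ?_ fun c hc => ?_
  · ext i j
    simp only [Matrix.conjTranspose_apply, star_trivial, metricMatrix, Matrix.of_apply]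
    exact coeff₂_inner_comm j i
  · let v : E n := ∑ i, c i • EuclideanSpace.single i 1
    have hv : v ≠ 0 := by
      intro h
      refine hc (funext fun i => ?_)
      have := congrArg (fun w : E n => w i) h
      simpa [v, Pi.single_apply] using this
    have hinj := (mdifferentiable_of_mem_atlas he).symm.mfderiv_injective hu
    have hne : mfderiv (𝓡 n) (𝓡 n) e.symm u v ≠ 0 := fun h =>
      hv (hinj (h.trans (map_zero _).symm))
    have hpos := g.pos _ _ hne
    have hexp : mfderiv (𝓡 n) (𝓡 n) e.symm u v = ∑ i, c i • coordVec e i u := by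
      refine (map_sum (mfderiv (𝓡 n) (𝓡 n) e.symm u) _ _).trans ?_
      exact Finset.sum_congr rfl fun i _ => map_smul _ _ _
    rw [hexp] at hpos
    refine hpos.trans_eq ?_
    simp only [map_sum, map_smul, sum_apply, smul_apply, smul_eq_mul, dotProduct,
      Matrix.mulVec, star_trivial, Finset.mul_sum, metricMatrix, Matrix.of_apply, coeff₂]
    rw [Finset.sum_comm]
    refine Finset.sum_congr rfl fun i _ => Finset.sum_congr rfl fun j _ => ?_
    ring

theorem isUnit_det_metricMatrix (he : e ∈ atlas (E n) M) (hu : u ∈ e.target) :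
    IsUnit (metricMatrix g e u).det :=
  (posDef_metricMatrix he hu).det_pos.ne'.isUnit

/-- The second fundamental form is normal. -/
theorem inner_secondFundamentalForm_partialD (hφ : IsIsometricImmersion g φ)
    (he : e ∈ atlas (E n) M) (hu : u ∈ e.target) (i j l : Fin n) :
    inner ℝ (secondFundamentalForm g φ e i j u) (partialD l (φ ∘ e.symm) u) = 0 := by
  have hc := contDiffAt_comp_symm hφ he hu
  let a : Fin n → ℝ := fun l => inner ℝ (partialD i (partialD j (φ ∘ e.symm)) u)
    (partialD l (φ ∘ e.symm) u)
  have h1 : ∀ k, christoffel g e k i j u = ((metricMatrix g e u)⁻¹).mulVec a k := fun k => by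
    rw [christoffel, Finset.mul_sum]
    refine Finset.sum_congr rfl fun l _ => ?_
    -- Expanding the metric derivatives by the product rule, symmetry of second partials cancels all
    -- terms but twice `a l`.
    have : a l = 1 / 2 * (partialD i (coeff₂ g.inner e j l) u + partialD j (coeff₂ g.inner e i l) u
        - partialD l (coeff₂ g.inner e i j) u) := by
      simp only [partialD_coeff₂_inner hφ he hu, a]
      rw [partialD_comm hc j i, partialD_comm hc l i, partialD_comm hc l j,
        real_inner_comm (partialD i (partialD l (φ ∘ e.symm)) u)]
      ring
    rw [this]; ring
  -- The Christoffel symbols are `G⁻¹a`, so pairing with the metric returns `a`: they describe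
  -- exactly the tangential part of the second derivative.
  have h2 : ∑ k, christoffel g e k i j u *
      inner ℝ (partialD k (φ ∘ e.symm) u) (partialD l (φ ∘ e.symm) u) = a l := by
    have : (metricMatrix g e u).mulVec (((metricMatrix g e u)⁻¹).mulVec a) = a := by
      rw [Matrix.mulVec_mulVec, Matrix.mul_nonsing_inv _ (isUnit_det_metricMatrix he hu),
        Matrix.one_mulVec]
    rw [← congrFun this l]
    refine Finset.sum_congr rfl fun k _ => ?_
    rw [h1, ← coeff₂_inner hφ he hu, coeff₂_inner_comm k l, mul_comm]
    rfl
  rw [secondFundamentalForm, inner_sub_left, sum_inner]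
  simp only [real_inner_smul_left]
  rw [h2, sub_self]

/-- The formula `∇θ = g + ⟨𝐱, h⟩` for `θ = (𝐱ᵀ)♭`. -/
theorem covDeriv₁_flat (hφ : IsIsometricImmersion g φ) (he : e ∈ atlas (E n) M)
    (hu : u ∈ e.target) (i j : Fin n) :
    covDeriv₁ g (flat g (canonicalField φ)) e i j u
      = metricMatrix g e u i j
        + inner ℝ ((φ ∘ e.symm) u) (secondFundamentalForm g φ e i j u) := by
  rw [covDeriv₁, partialD_coeff₁_flat hφ he hu, secondFundamentalForm, inner_sub_right, inner_sum]
  simp only [real_inner_smul_right, coeff₁_flat_canonicalField hφ he hu, metricMatrix,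
    Matrix.of_apply]
  ring

/-- The trace `∑ᵢⱼ gⁱʲ ⟨𝐱, h(∂ᵢ, ∂ⱼ)⟩` in the chart `e`. -/
def traceInner (g : RiemannianMetric n M) (φ : M → E m) (e : OpenPartialHomeomorph M (E n))
    (u : E n) : ℝ :=
  ∑ i, ∑ j, (metricMatrix g e u)⁻¹ i j *
    inner ℝ ((φ ∘ e.symm) u) (secondFundamentalForm g φ e i j u)

theorem sum_inv_mul_metricMatrix (he : e ∈ atlas (E n) M) (hu : u ∈ e.target) :
    ∑ i, ∑ j, (metricMatrix g e u)⁻¹ i j * metricMatrix g e u i j = n := by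
  have hsymm : ∀ i j, metricMatrix g e u i j = metricMatrix g e u j i := fun i j =>
    coeff₂_inner_comm i j
  have := congrArg Matrix.trace
    (Matrix.nonsing_inv_mul _ (isUnit_det_metricMatrix (g := g) he hu))
  rw [Matrix.trace_one, Fintype.card_fin] at this
  rw [← this]
  simp only [Matrix.trace, Matrix.diag_apply, Matrix.mul_apply]
  exact Finset.sum_congr rfl fun i _ => Finset.sum_congr rfl fun j _ => by rw [hsymm i j]

theorem sum_inv_mul_covDeriv₁_flat (hφ : IsIsometricImmersion g φ) (he : e ∈ atlas (E n) M)
    (hu : u ∈ e.target) :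
    ∑ i, ∑ j, (metricMatrix g e u)⁻¹ i j * covDeriv₁ g (flat g (canonicalField φ)) e i j u
      = n + traceInner g φ e u := by
  simp only [covDeriv₁_flat hφ he hu, mul_add, Finset.sum_add_distrib,
    sum_inv_mul_metricMatrix he hu, traceInner]

theorem codiff₁_flat (hφ : IsIsometricImmersion g φ) (q : M) :
    codiff₁ g (flat g (canonicalField φ)) q
      = -(n + traceInner g φ (chartAt (E n) q) (chartAt (E n) q q)) := by
  rw [codiff₁, sum_inv_mul_covDeriv₁_flat hφ (chart_mem_atlas _ _) (mem_chart_target _ _)]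
  ring

theorem inner_meanCurvature (φ : M → E m) (q : M) :
    inner ℝ (φ q) (meanCurvature g φ q)
      = (1 / n) * traceInner g φ (chartAt (E n) q) (chartAt (E n) q q) := by
  simp only [meanCurvature, traceInner, real_inner_smul_right, inner_sum, Function.comp_apply,
    OpenPartialHomeomorph.left_inv _ (mem_chart_source (E n) q)]

end Chart

/-! ### Smoothness of determinants and inverse matrices -/

section Smoothness

variable {V : Type*} [NormedAddCommGroup V] [NormedSpace ℝ V] {n : ℕ} {x : V}

theorem contDiffAt_det {A : V → Matrix (Fin n) (Fin n) ℝ}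
    (hA : ∀ i j, ContDiffAt ℝ ∞ (fun v => A v i j) x) :
    ContDiffAt ℝ ∞ (fun v => (A v).det) x := by
  simp only [Matrix.det_apply]
  exact ContDiffAt.sum fun σ _ => (contDiffAt_prod fun i _ => hA _ _).const_smul _

/-- Cramer's rule: the inverse is the adjugate, with determinants as entries, divided by the
determinant. -/
theorem contDiffAt_inv_apply {A : V → Matrix (Fin n) (Fin n) ℝ}
    (hA : ∀ i j, ContDiffAt ℝ ∞ (fun v => A v i j) x) (hdet : (A x).det ≠ 0) (i j : Fin n) :
    ContDiffAt ℝ ∞ (fun v => (A v)⁻¹ i j) x := by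
  have hadj : ContDiffAt ℝ ∞ (fun v => (A v).adjugate i j) x := by
    simp only [Matrix.adjugate_apply]
    refine contDiffAt_det fun k l => ?_
    simp only [Matrix.updateRow_apply]
    split_ifs
    · exact contDiffAt_const
    · exact hA k l
  simp only [Matrix.inv_def, Ring.inverse_eq_inv', Matrix.smul_apply, smul_eq_mul]
  exact ((contDiffAt_det hA).inv hdet).mul hadj

end Smoothness

/-! ### Smoothness of the coordinate expressions -/

section Chart

variable {n m : ℕ} {M : Type*} [TopologicalSpace M] [ChartedSpace (E n) M]
  [IsManifold (𝓡 n) ∞ M] {g : RiemannianMetric n M} {φ : M → E m}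
  {e e' : OpenPartialHomeomorph M (E n)} {u : E n}

theorem contDiffAt_coeff₂_inner (hφ : IsIsometricImmersion g φ) (he : e ∈ atlas (E n) M)
    (hu : u ∈ e.target) (i j : Fin n) : ContDiffAt ℝ ∞ (coeff₂ g.inner e i j) u := by
  have hc := contDiffAt_comp_symm hφ he hu
  exact ((contDiffAt_partialD hc i).inner ℝ (contDiffAt_partialD hc j)).congr_of_eventuallyEq
    ((eventually_mem_target hu).mono fun v hv => coeff₂_inner hφ he hv i j)

theorem contDiffAt_inv_metricMatrix (hφ : IsIsometricImmersion g φ) (he : e ∈ atlas (E n) M)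
    (hu : u ∈ e.target) (i j : Fin n) :
    ContDiffAt ℝ ∞ (fun v => (metricMatrix g e v)⁻¹ i j) u :=
  contDiffAt_inv_apply (fun k l => contDiffAt_coeff₂_inner hφ he hu k l)
    (posDef_metricMatrix he hu).det_pos.ne' i j

theorem contDiffAt_christoffel (hφ : IsIsometricImmersion g φ) (he : e ∈ atlas (E n) M)
    (hu : u ∈ e.target) (k i j : Fin n) : ContDiffAt ℝ ∞ (christoffel g e k i j) u := by
  have h : ∀ a b c, ContDiffAt ℝ ∞ (partialD a (coeff₂ g.inner e b c)) u := fun a b c =>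
    contDiffAt_partialD (contDiffAt_coeff₂_inner hφ he hu b c) a
  exact contDiffAt_const.mul (ContDiffAt.sum fun l _ =>
    (contDiffAt_inv_metricMatrix hφ he hu k l).mul (((h i j l).add (h j i l)).sub (h l i j)))

theorem contDiffAt_secondFundamentalForm (hφ : IsIsometricImmersion g φ)
    (he : e ∈ atlas (E n) M) (hu : u ∈ e.target) (i j : Fin n) :
    ContDiffAt ℝ ∞ (secondFundamentalForm g φ e i j) u := by
  have hc := contDiffAt_comp_symm hφ he hu
  exact (contDiffAt_partialD (contDiffAt_partialD hc j) i).sub (ContDiffAt.sum fun k _ =>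
    (contDiffAt_christoffel hφ he hu k i j).smul (contDiffAt_partialD hc k))

theorem contDiffAt_traceInner (hφ : IsIsometricImmersion g φ) (he : e ∈ atlas (E n) M)
    (hu : u ∈ e.target) : ContDiffAt ℝ ∞ (traceInner g φ e) u :=
  ContDiffAt.sum fun i _ => ContDiffAt.sum fun j _ =>
    (contDiffAt_inv_metricMatrix hφ he hu i j).mul
      ((contDiffAt_comp_symm hφ he hu).inner ℝ (contDiffAt_secondFundamentalForm hφ he hu i j))

/-! ### Chart independence of the trace -/

/-- The normal component of the position vector. -/
def normalPart (n : ℕ) {M : Type*} [TopologicalSpace M] [ChartedSpace (E n) M] (φ : M → E m)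
    (p : M) : E m :=
  φ p - (tangentRange (n := n) φ p).starProjection (φ p)

omit [IsManifold (𝓡 n) ∞ M] in
theorem inner_normalPart (φ : M → E m) (p : M) (v : TangentSpace (𝓡 n) p) :
    inner ℝ (normalPart n φ p) (mvfderiv (𝓡 n) φ p v) = 0 :=
  Submodule.starProjection_inner_eq_zero _ _ ⟨v, rfl⟩

theorem inner_normalPart_fderiv (hφ : IsIsometricImmersion g φ)
    (he : e ∈ atlas (E n) M) (hu : u ∈ e.target) (v : E n) :
    inner ℝ (normalPart n φ (e.symm u)) (fderiv ℝ (φ ∘ e.symm) u v) = 0 := by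
  rw [fderiv_comp_symm hφ he hu]
  exact inner_normalPart φ _ _

/-- Both corrections vanish by orthogonality: `h` is normal, so only the normal part of the position
counts, and the Christoffel terms are tangent. The resulting expression has no Christoffel symbols,
so their transformation law is never needed. -/
theorem inner_secondFundamentalForm (hφ : IsIsometricImmersion g φ)
    (he : e ∈ atlas (E n) M) (hu : u ∈ e.target) (i j : Fin n) :
    inner ℝ ((φ ∘ e.symm) u) (secondFundamentalForm g φ e i j u)
      = inner ℝ (normalPart n φ (e.symm u)) (partialD i (partialD j (φ ∘ e.symm)) u) := by
  obtain ⟨w, hw⟩ := exists_tangent_part (n := n) φ (e.symm u)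
  obtain ⟨v, rfl⟩ : ∃ v : E n, mfderiv (𝓡 n) (𝓡 n) e.symm u v = w :=
    (mdifferentiable_of_mem_atlas he).symm.mfderiv_surjective hu w
  have hw' : fderiv ℝ (φ ∘ e.symm) u v
      = (tangentRange (n := n) φ (e.symm u)).starProjection (φ (e.symm u)) :=
    (fderiv_comp_symm hφ he hu v).trans hw
  have hdec : (φ ∘ e.symm) u
      = normalPart n φ (e.symm u) + ∑ k, v k • partialD k (φ ∘ e.symm) u := by
    have : ∑ k, v k • partialD k (φ ∘ e.symm) u = fderiv ℝ (φ ∘ e.symm) u v := by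
      conv_rhs => rw [← sum_smul_single v]
      rw [map_sum]
      exact Finset.sum_congr rfl fun k _ => (map_smul _ _ _).symm
    rw [this, hw', normalPart, Function.comp_apply, sub_add_cancel]
  rw [hdec, inner_add_left, sum_inner]
  have h0 : ∀ k, inner ℝ (v k • partialD k (φ ∘ e.symm) u)
      (secondFundamentalForm g φ e i j u) = 0 := fun k => by
    rw [real_inner_smul_left, real_inner_comm,
      inner_secondFundamentalForm_partialD hφ he hu, mul_zero]
  rw [Finset.sum_eq_zero fun k _ => h0 k, add_zero, secondFundamentalForm, inner_sub_right,
    inner_sum]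
  rw [Finset.sum_eq_zero fun k _ => ?_, sub_zero]
  rw [real_inner_smul_right, partialD, inner_normalPart_fderiv hφ he hu, mul_zero]

/-- The trace does not depend on the chart. -/
theorem traceInner_transition (hφ : IsIsometricImmersion g φ) (he : e ∈ atlas (E n) M)
    (he' : e' ∈ atlas (E n) M) (hu : u ∈ e.target) (hu' : e.symm u ∈ e'.source) :
    traceInner g φ e u = traceInner g φ e' (e' (e.symm u)) := by
  have hψ := contDiffAt_transition he he' hu hu'
  set ψ : E n → E n := e' ∘ e.symm with hψdef
  have hv : ψ u ∈ e'.target := e'.map_source hu'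
  have hp : e'.symm (ψ u) = e.symm u := e'.left_inv hu'
  have hΦ := contDiffAt_comp_symm hφ he hu
  have hΦ' := contDiffAt_comp_symm hφ he' hv
  have heq : φ ∘ e.symm =ᶠ[𝓝 u] (φ ∘ e'.symm) ∘ ψ := by
    filter_upwards [(e.continuousAt_symm hu).eventually (e'.open_source.mem_nhds hu')] with v hv
    simp [ψ, e'.left_inv hv]
  set T := fderiv ℝ ψ u
  have hT : ∀ v, fderiv ℝ (φ ∘ e.symm) u v = fderiv ℝ (φ ∘ e'.symm) (ψ u) (T v) := fun v => by
    rw [heq.fderiv_eq, fderiv_comp u (hΦ'.differentiableAt (by simp))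
      (hψ.differentiableAt (by simp))]
    rfl
  let G : E n →L[ℝ] E n →L[ℝ] ℝ := (innerSL ℝ).bilinearComp
    (fderiv ℝ (φ ∘ e'.symm) (ψ u)) (fderiv ℝ (φ ∘ e'.symm) (ψ u))
  let B : E n →L[ℝ] E n →L[ℝ] ℝ := (ContinuousLinearMap.compL ℝ (E n) (E m) ℝ
    (innerSL ℝ (normalPart n φ (e.symm u)))) ∘L fderiv ℝ (fderiv ℝ (φ ∘ e'.symm)) (ψ u)
  have hG' : metricMatrix g e' (ψ u)
      = Matrix.of fun i j => G (EuclideanSpace.single i 1) (EuclideanSpace.single j 1) := by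
    ext i j
    exact coeff₂_inner hφ he' hv i j
  have hG : metricMatrix g e u
      = Matrix.of fun i j => G (T (EuclideanSpace.single i 1)) (T (EuclideanSpace.single j 1)) := by
    ext i j
    rw [metricMatrix_apply, coeff₂_inner hφ he hu, partialD, partialD, hT, hT]
    rfl
  have hB' : ∀ i j, inner ℝ ((φ ∘ e'.symm) (ψ u)) (secondFundamentalForm g φ e' i j (ψ u))
      = Matrix.of (fun i j => B (EuclideanSpace.single i 1) (EuclideanSpace.single j 1)) i j := by
    intro i j
    rw [inner_secondFundamentalForm hφ he' hv, hp, partialD_partialD hΦ']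
    rfl
  have hB : ∀ i j, inner ℝ ((φ ∘ e.symm) u) (secondFundamentalForm g φ e i j u)
      = Matrix.of (fun i j => B (T (EuclideanSpace.single i 1))
          (T (EuclideanSpace.single j 1))) i j := by
    intro i j
    rw [inner_secondFundamentalForm hφ he hu, partialD_partialD hΦ, heq.fderiv.fderiv_eq,
      sndFDeriv_comp hψ hΦ', inner_add_right]
    -- The second derivative of the transition map contributes only a tangent vector, which the
    -- normal part kills; what remains transforms as a bilinear form.
    have := inner_normalPart_fderiv hφ he' hv
      (fderiv ℝ (fderiv ℝ ψ) u (EuclideanSpace.single i 1) (EuclideanSpace.single j 1))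
    rw [hp] at this
    rw [this, add_zero]
    rfl
  have hdet := isUnit_det_metricMatrix (g := g) he hu
  -- The Jacobian is invertible because it is a factor of the invertible metric matrix of `e`.
  rw [hG, bilin_map_single, Matrix.det_mul] at hdet
  change traceInner g φ e u = traceInner g φ e' (ψ u)
  simp only [traceInner, hB, hB', hG', hG]
  rw [bilin_map_single, bilin_map_single]
  exact sum_inv_mul_congr (isUnit_of_mul_isUnit_right hdet)

/-! ### Maximum principle and the vanishing of the codifferential -/

/-- The maximum principle for `s |𝐱|² / 2`, whose Laplacian is `s (n + ⟨𝐱, trace h⟩)`. -/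
theorem mul_traceInner_nonpos_of_isLocalMax (hφ : IsIsometricImmersion g φ)
    (he : e ∈ atlas (E n) M) (hu : u ∈ e.target) (s : ℝ)
    (hmax : IsLocalMax (fun v => s / 2 * inner ℝ ((φ ∘ e.symm) v) ((φ ∘ e.symm) v)) u) :
    s * (n + traceInner g φ e u) ≤ 0 := by
  set f : E n → ℝ := fun v => s / 2 * inner ℝ ((φ ∘ e.symm) v) ((φ ∘ e.symm) v) with hf
  have hfc : ∀ v ∈ e.target, ContDiffAt ℝ ∞ f v := fun v hv =>
    contDiffAt_const.mul
      ((contDiffAt_comp_symm hφ he hv).inner ℝ (contDiffAt_comp_symm hφ he hv))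
  have hpart : ∀ v ∈ e.target, ∀ j,
      partialD j f v = s * coeff₁ (flat g (canonicalField φ)) e j v := fun v hv j => by
    have hd := (contDiffAt_comp_symm hφ he hv).differentiableAt (by simp)
    have h1 := partialD_inner hd hd j
    have h2 : partialD j f v = s / 2 * partialD j
        (fun w => inner ℝ ((φ ∘ e.symm) w) ((φ ∘ e.symm) w)) v := by
      rw [partialD, hf, fderiv_const_mul (hd.inner ℝ hd)]
      rfl
    rw [h2, h1, coeff₁_flat_canonicalField hφ he hv, real_inner_comm]
    ring
  have hcov : ∀ i j, s * covDeriv₁ g (flat g (canonicalField φ)) e i j u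
      = partialD i (partialD j f) u := fun i j => by
    -- At the critical point `df = sθ` vanishes, so the Christoffel terms drop out and the covariant
    -- Hessian is the coordinate Hessian.
    have hz : ∀ k, s * coeff₁ (flat g (canonicalField φ)) e k u = 0 := fun k => by
      rw [← hpart u hu k, partialD, hmax.fderiv_eq_zero]
      rfl
    have h3 : partialD i (partialD j f) u
        = s * partialD i (coeff₁ (flat g (canonicalField φ)) e j) u := by
      have hc := contDiffAt_comp_symm hφ he hu
      have hd : DifferentiableAt ℝ (coeff₁ (flat g (canonicalField φ)) e j) u :=
        ((hc.inner ℝ (contDiffAt_partialD hc j)).congr_of_eventuallyEq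
          ((eventually_mem_target hu).mono fun v hv =>
            coeff₁_flat_canonicalField hφ he hv j)).differentiableAt (by simp)
      rw [partialD_congr ((eventually_mem_target hu).mono fun v hv => hpart v hv j) i, partialD,
        fderiv_const_mul hd]
      rfl
    rw [h3, covDeriv₁, mul_sub, Finset.mul_sum]
    rw [Finset.sum_eq_zero fun k _ => ?_, sub_zero]
    rw [mul_left_comm, hz, mul_zero]
  rw [← sum_inv_mul_covDeriv₁_flat hφ he hu]
  simp only [Finset.mul_sum, mul_left_comm s, hcov]
  refine sum_mul_nonpos_of_posSemidef (B := Matrix.of fun i j => partialD i (partialD j f) u)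
    (posDef_metricMatrix he hu).inv.posSemidef fun c => ?_
  have h := sndFDeriv_self_nonpos_of_isLocalMax ((hfc u hu).of_le (by norm_cast)) hmax
    (∑ i, c i • EuclideanSpace.single i 1)
  simp only [Matrix.of_apply, partialD_partialD (hfc u hu)]
  simp only [map_sum, map_smul, sum_apply, smul_apply, smul_eq_mul, Finset.mul_sum] at h
  rw [Finset.sum_comm]
  refine le_of_eq_of_le ?_ h
  exact Finset.sum_congr rfl fun i _ => Finset.sum_congr rfl fun j _ => by ring

/-- Expresses the codifferential near a point in one fixed chart, as needed to differentiate it. -/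
theorem codiff₁_flat_of_mem (hφ : IsIsometricImmersion g φ) (he : e ∈ atlas (E n) M) {q : M}
    (hq : q ∈ e.source) :
    codiff₁ g (flat g (canonicalField φ)) q = -(n + traceInner g φ e (e q)) := by
  rw [codiff₁_flat hφ, traceInner_transition hφ he (chart_mem_atlas (E n) q) (e.map_source hq)
    (by rw [e.left_inv hq]; exact mem_chart_source _ q), e.left_inv hq]

theorem mdifferentiableAt_codiff₁_flat (hφ : IsIsometricImmersion g φ) (q : M) :
    MDifferentiableAt (𝓡 n) 𝓘(ℝ, ℝ) (codiff₁ g (flat g (canonicalField φ))) q := by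
  have he := chart_mem_atlas (E n) q
  have hq := mem_chart_source (E n) q
  have hd : DifferentiableAt ℝ (fun v => -(n + traceInner g φ (chartAt (E n) q) v))
      (chartAt (E n) q q) :=
    (((contDiffAt_traceInner hφ he (mem_chart_target _ q)).differentiableAt
      (by simp)).const_add _).neg
  have := hd.mdifferentiableAt.comp q ((mdifferentiable_of_mem_atlas he).mdifferentiableAt hq)
  refine this.congr_of_eventuallyEq ?_
  filter_upwards [(chartAt (E n) q).open_source.mem_nhds hq] with q' hq'
  exact codiff₁_flat_of_mem hφ he hq'

theorem isLocallyConstant_of_mvfderiv_eq_zero {f : M → ℝ}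
    (hf : ∀ q, MDifferentiableAt (𝓡 n) 𝓘(ℝ, ℝ) f q) (h : ∀ q, mvfderiv (𝓡 n) f q = 0) :
    IsLocallyConstant f := by
  rw [IsLocallyConstant.iff_eventually_eq]
  intro q
  set e := chartAt (E n) q
  have he : e ∈ atlas (E n) M := chart_mem_atlas (E n) q
  -- A ball in the chart target is connected, so a vanishing derivative gives constancy there.
  obtain ⟨r, hr, hball⟩ := Metric.isOpen_iff.1 e.open_target (e q) (mem_chart_target (E n) q)
  have hmd : ∀ u ∈ e.target, MDifferentiableAt (𝓡 n) 𝓘(ℝ, ℝ) (f ∘ e.symm) u := fun u hu =>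
    (hf _).comp u ((mdifferentiable_of_mem_atlas he).mdifferentiableAt_symm hu)
  have hzero : ∀ u ∈ e.target, fderiv ℝ (f ∘ e.symm) u = 0 := fun u hu => by
    rw [← mfderiv_eq_fderiv]
    ext v
    have := mvfderiv_comp_apply u (hf _)
      ((mdifferentiable_of_mem_atlas he).mdifferentiableAt_symm hu) v
    rw [h] at this
    exact this
  filter_upwards [(e.continuousAt (mem_chart_source (E n) q)).eventually
    (Metric.ball_mem_nhds _ hr), e.open_source.mem_nhds (mem_chart_source (E n) q)] with p hp hp'
  have := (Metric.isOpen_ball (x := e q) (ε := r)).is_const_of_fderiv_eq_zero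
    (convex_ball (e q) r).isPreconnected
    (fun u hu => (hmd u (hball hu)).differentiableAt.differentiableWithinAt)
    (fun u hu => hzero u (hball hu)) hp (Metric.mem_ball_self hr)
  simpa [e.left_inv hp', e.left_inv (mem_chart_source (E n) q)] using this

theorem isHarmonicForm_flat_iff (hφ : IsIsometricImmersion g φ) :
    IsHarmonicForm g (flat g (canonicalField φ)) ↔
      ∀ q, mvfderiv (𝓡 n) (codiff₁ g (flat g (canonicalField φ))) q = 0 := by
  simp only [IsHarmonicForm, hodgeLaplacian, extDeriv₁_flat_canonicalField hφ, codiff₂_zero,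
    Pi.zero_apply, add_zero]

/-- On a compact manifold, `δ(𝐱ᵀ)♭` vanishes as soon as it is locally constant. -/
theorem codiff₁_flat_eq_zero [CompactSpace M] (hφ : IsIsometricImmersion g φ)
    (hconst : IsLocallyConstant (codiff₁ g (flat g (canonicalField φ)))) (p : M) :
    codiff₁ g (flat g (canonicalField φ)) p = 0 := by
  set c := codiff₁ g (flat g (canonicalField φ))
  -- The fibre is compact because closed, and a maximum on it is a local maximum on `M` because it
  -- is open; `M` need not be connected.
  have hS : IsClopen {q | c q = c p} := hconst.isClopen_fiber (c p)
  have key : ∀ s : ℝ, 0 ≤ s * c p := fun s => by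
    have hcont : Continuous fun q => s / 2 * inner ℝ (φ q) (φ q) :=
      continuous_const.mul (hφ.contMDiff.continuous.inner hφ.contMDiff.continuous)
    obtain ⟨q, hq, hmax⟩ := hS.isClosed.isCompact.exists_isMaxOn ⟨p, rfl⟩ hcont.continuousOn
    have hloc : IsLocalMax (fun q => s / 2 * inner ℝ (φ q) (φ q)) q :=
      hmax.isLocalMax (hS.isOpen.mem_nhds hq)
    have hu := mem_chart_target (E n) q
    have hinv := (chartAt (E n) q).left_inv (mem_chart_source (E n) q)
    have hloc' : IsLocalMax (fun v => s / 2 * inner ℝ ((φ ∘ (chartAt (E n) q).symm) v)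
        ((φ ∘ (chartAt (E n) q).symm) v)) (chartAt (E n) q q) := by
      have ht := ((chartAt (E n) q).continuousAt_symm hu).tendsto
      rw [hinv] at ht
      refine (ht.eventually hloc).mono fun v hv => ?_
      simpa only [Function.comp_apply, hinv] using hv
    have := mul_traceInner_nonpos_of_isLocalMax hφ (chart_mem_atlas _ q) hu s hloc'
    have hcq : c q = c p := hq
    rw [← hcq]
    simp only [c]
    rw [codiff₁_flat hφ]
    linarith
  -- The value `s = 1` uses a maximum of `|𝐱|²`, and `s = -1` a minimum.
  linarith [key 1, key (-1)]

theorem codiff₁_flat_eq (hn : 1 ≤ n) (hφ : IsIsometricImmersion g φ) (p : M) :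
    codiff₁ g (flat g (canonicalField φ)) p
      = -n * (1 + inner ℝ (φ p) (meanCurvature g φ p)) := by
  have : (n : ℝ) ≠ 0 := by positivity
  rw [codiff₁_flat hφ, inner_meanCurvature]
  field_simp

end Chart

end EuclideanSubmanifold
end

open EuclideanSubmanifold in
theorem corollaryC {n m : ℕ} (hn : 1 ≤ n)
    {M : Type*} [TopologicalSpace M] [T2Space M] [CompactSpace M]
    [ChartedSpace (EuclideanSpace ℝ (Fin n)) M] [IsManifold (𝓡 n) ∞ M]
    (g : EuclideanSubmanifold.RiemannianMetric n M)
    (φ : M → EuclideanSpace ℝ (Fin m))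
    (hφ : EuclideanSubmanifold.IsIsometricImmersion g φ) :
    EuclideanSubmanifold.IsHarmonicForm g
        (EuclideanSubmanifold.flat g (EuclideanSubmanifold.canonicalField φ)) ↔
      ∀ p : M, inner ℝ (φ p) (EuclideanSubmanifold.meanCurvature g φ p) = -1 := by
  have hn' : (-n : ℝ) ≠ 0 := neg_ne_zero.2 (by positivity)
  rw [isHarmonicForm_flat_iff hφ]
  constructor
  · intro h p
    have h0 := codiff₁_flat_eq_zero hφ (isLocallyConstant_of_mvfderiv_eq_zero
      (mdifferentiableAt_codiff₁_flat hφ) h) p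
    rw [codiff₁_flat_eq hn hφ] at h0
    linarith [(mul_eq_zero.1 h0).resolve_left hn']
  -- This direction is local and does not use compactness.
  · intro h q
    have h0 : codiff₁ g (flat g (canonicalField φ)) = fun _ => 0 := funext fun p => by
      rw [codiff₁_flat_eq hn hφ, h, add_neg_cancel, mul_zero]
    rw [h0]
    exact mvfderiv_const 0
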